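/- **Setting.** A finite graph $X$ has a finite vertex set, a finite set $\mathcal A$ of edges with a fixed-point-free involution $a\mapsto -a$, and an origin $o(a)$ and an extremity $e(a)=o(-a)$ for every edge $a$; loops and multiple edges are allowed. An orientation $\mathcal A^+$ contains exactly one edge of each pair $\{a,-a\}$. A graph of groups $(\mathcal G,X)$ is a finite connected oriented graph $X$ with a group $G_s$ for each vertex $s$, a group $G_a=G_{-a}$ for each $a\in\mathcal A^+$, and injective homomorphisms $\phi_a:G_a\to G_{o(a)}$ for all $a\in\mathcal A$ (so $\phi_{-a}:G_a\to G_{e(a)}$). A decomposed graph of groups $(\mathcal G,X,T)$ is a graph of groups with a maximal tree $T$ of $X$, that is, a subgraph that is a tree and contains all vertices of $X$. Its fundamental group $\pi_1(\mathcal G,X)$ is the quotient of the free product of all $G_s$ and of the free group on $\{t_a : a\in\mathcal A\}$ by the relations $\phi_a(h)=t_a\,\phi_{-a}(h)\,t_a^{-1}$ ($a\in\mathcal A^+$, $h\in G_a$), $t_{-a}=t_a^{-1}$ ($a\in\mathcal A$), and $t_a=1$ ($a$ an edge of $T$). Each $G_s$ is identified with its image in $\pi_1(\mathcal G,X)$ under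 the natural map (which is injective); it is called a vertex subgroup. Let $s$ be a vertex and $u\in G_s$. A circuit at $u$ with origin $s$ consists of a closed path $(a_1,\dots,a_n)$ in $X$, $n\ge 0$, with successive vertices $s=s_0,s_1,\dots,s_n=s$, of elements $c_i\in G_{a_i}$ ($1\le i\le n$), and of elements $h_i\in G_{s_i}$ ($0\le i\le n$), such that, writing $c_i^-=\phi_{a_i}(c_i)$ and $c_i^+=\phi_{-a_i}(c_i)$, $$u=h_0c_1^-h_0^{-1}\ \text{ in } G_{s_0},\qquad c_i^+=h_ic_{i+1}^-h_i^{-1}\ \text{ in } G_{s_i}\ (1\le i<n),\qquad c_n^+=h_nuh_n^{-1}\ \text{ in } G_{s_n}$$ (if $n=0$, the condition is $u=h_0uh_0^{-1}$). The circuit is trivial if $n=0$. It is reduced if there is no $i$ with $1\le i<n$, $a_{i+1}=-a_i$ and $h_i\in\phi_{-a_i}(G_{a_i})$. The graph of groups is without circuit if, for every vertex $s$ and every $u\in G_s$ with $u\neq1$, every reduced circuit at $u$ with origin $s$ is trivial. **Theorem.** Let $(\mathcal G,X,T)$ be a decomposed graph of groups without circuit, let $u\ne1$ be an element of $\pi_1(\mathcal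 G,X)$, and let $\mathcal Z(u)$ be the centralizer of $u$ in $\pi_1(\mathcal G,X)$. 1. If $u$ lies in a vertex subgroup $G_s$, then $\mathcal Z(u)$ is the centralizer of $u$ in $G_s$. 2. If $u$ lies in no conjugate of a vertex subgroup, then $\mathcal Z(u)$ is infinite cyclic. -/

import Mathlib

universe u₁ u₂ u₃ u₄

/-- An oriented graph with vertex set `V`, given by its set `E` of positively oriented edges with
their origins and extremities.  The set of all edges is `E × Bool`: `(e, true)` is the positive
edge `e` and `(e, false)` is the opposite edge `-e`. Loops and multiple edges are allowed. -/
structure OrientedGraph (V : Type u₁) (E : Type u₂) where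
  /-- origin of a positive edge -/
  src : E → V
  /-- extremity of a positive edge -/
  tgt : E → V

namespace OrientedGraph

variable {V : Type u₁} {E : Type u₂}

/-- The fixed-point-free involution `a ↦ -a` on edges. -/
def inv (a : E × Bool) : E × Bool := (a.1, !a.2)

/-- The origin of an edge. -/
def org (X : OrientedGraph V E) : E × Bool → V
  | (e, true) => X.src e
  | (e, false) => X.tgt e

/-- The extremity of an edge. -/
def ext (X : OrientedGraph V E) (a : E × Bool) : V := X.org (inv a)

/-- `X.IsPath s l t`: the sequence of edges `l` is a path with origin `s` and extremity `t`
(the empty sequence is a path from `s` to `s`). -/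
def IsPath (X : OrientedGraph V E) : V → List (E × Bool) → V → Prop
  | s, [], t => s = t
  | s, a :: l, t => X.org a = s ∧ X.IsPath (X.ext a) l t

/-- A sequence of edges is reduced if no edge is followed by its opposite. -/
def IsReducedPath (l : List (E × Bool)) : Prop :=
  l.IsChain (fun a b => b ≠ inv a)

/-- The subgraph with all the vertices of `X` and with the edges `±e`, `e ∈ T`, is a tree:
any two vertices are joined by a unique reduced path in it. -/
def IsMaximalTree (X : OrientedGraph V E) (T : Set E) : Prop :=
  ∀ s t : V, ∃! l : List (E × Bool),
    X.IsPath s l t ∧ IsReducedPath l ∧ ∀ a ∈ l, a.1 ∈ T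

end OrientedGraph

/-- A graph of groups on an oriented graph: a group for each vertex, a group for each
positive edge `e` (shared by `e` and `-e`), and for each edge `a` a monomorphism `φ a` from the
group of `±a` to the group of the origin of `a`. -/
structure GraphOfGroups (V : Type u₁) (E : Type u₂) where
  /-- the underlying oriented graph -/
  graph : OrientedGraph V E
  /-- the vertex groups -/
  Gv : V → Type u₃
  /-- the edge groups -/
  Ge : E → Type u₄
  [groupV : ∀ s, Group (Gv s)]
  [groupE : ∀ e, Group (Ge e)]
  /-- the monomorphisms `φ_a` and `φ_{-a}` -/
  φ : ∀ a : E × Bool, Ge a.1 →* Gv (graph.org a)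
  φ_injective : ∀ a, Function.Injective (φ a)

namespace GraphOfGroups

open OrientedGraph

attribute [instance] GraphOfGroups.groupV GraphOfGroups.groupE

variable {V : Type u₁} {E : Type u₂}

/-- The monomorphism `φ_{-a}`, from the group of `±a` to the group of the extremity of `a`. -/
def φExt (𝒢 : GraphOfGroups.{u₁, u₂, u₃, u₄} V E) (a : E × Bool) :
    𝒢.Ge a.1 →* 𝒢.Gv (𝒢.graph.ext a) :=
  𝒢.φ (inv a)

/-- The free product of all the vertex groups and of the free group on the `t_a`, `a` an edge. -/
abbrev FreeProd (𝒢 : GraphOfGroups.{u₁, u₂, u₃, u₄} V E) : Type (max u₁ u₂ u₃) :=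
  Monoid.Coprod (Monoid.CoprodI 𝒢.Gv) (FreeGroup (E × Bool))

/-- An element of a vertex group in the free product. -/
def freeVertex (𝒢 : GraphOfGroups.{u₁, u₂, u₃, u₄} V E) (s : V) : 𝒢.Gv s →* 𝒢.FreeProd :=
  Monoid.Coprod.inl.comp Monoid.CoprodI.of

/-- The generator `t_a` in the free product. -/
def freeEdge (𝒢 : GraphOfGroups.{u₁, u₂, u₃, u₄} V E) (a : E × Bool) : 𝒢.FreeProd :=
  Monoid.Coprod.inr (FreeGroup.of a)

/-- The relators expressing `φ_a(h) = t_a φ_{-a}(h) t_a⁻¹` for `a` a positive edge,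
`t_{-a} = t_a⁻¹` for every edge `a`, and `t_a = 1` for every edge `a` of `T`. -/
def relators (𝒢 : GraphOfGroups.{u₁, u₂, u₃, u₄} V E) (T : Set E) : Set 𝒢.FreeProd :=
  {r | ∃ (e : E) (h : 𝒢.Ge e),
      r = 𝒢.freeVertex (𝒢.graph.org (e, true)) (𝒢.φ (e, true) h) *
        (𝒢.freeEdge (e, true) * 𝒢.freeVertex (𝒢.graph.ext (e, true)) (𝒢.φExt (e, true) h) *
          (𝒢.freeEdge (e, true))⁻¹)⁻¹} ∪
  {r | ∃ a : E × Bool, r = 𝒢.freeEdge (inv a) * 𝒢.freeEdge a} ∪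
  {r | ∃ a : E × Bool, a.1 ∈ T ∧ r = 𝒢.freeEdge a}

/-- The fundamental group of the decomposed graph of groups `(𝒢, X, T)`. -/
abbrev Pi1 (𝒢 : GraphOfGroups.{u₁, u₂, u₃, u₄} V E) (T : Set E) : Type (max u₁ u₂ u₃) :=
  𝒢.FreeProd ⧸ Subgroup.normalClosure (𝒢.relators T)

/-- The natural map from the vertex group of `s` to the fundamental group; its range is the
vertex subgroup of `s`. -/
def vertexHom (𝒢 : GraphOfGroups.{u₁, u₂, u₃, u₄} V E) (T : Set E) (s : V) :
    𝒢.Gv s →* 𝒢.Pi1 T :=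
  (QuotientGroup.mk' (Subgroup.normalClosure (𝒢.relators T))).comp (𝒢.freeVertex s)

/-- `𝒢.Traj s u t v` is the type of trajectories from `u ∈ G_s` to `v ∈ G_t`, with origin `s` and
extremity `t`: a path `(a₁, …, aₙ)` from `s` to `t`, elements `cᵢ` of the groups of the edges
`aᵢ`, with images `cᵢ⁻ = φ_{aᵢ}(cᵢ)` and `cᵢ⁺ = φ_{-aᵢ}(cᵢ)`, and elements `h₀, …, hₙ` of the
groups of the successive vertices of the path, such that `u = h₀ c₁⁻ h₀⁻¹`,
`cᵢ⁺ = hᵢ cᵢ₊₁⁻ hᵢ⁻¹` for `0 < i < n`, and `cₙ⁺ = hₙ v hₙ⁻¹`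
(and `u = h₀ v h₀⁻¹` when `n = 0`). -/
inductive Traj (𝒢 : GraphOfGroups.{u₁, u₂, u₃, u₄} V E) :
    (s : V) → 𝒢.Gv s → (t : V) → 𝒢.Gv t → Type (max u₁ u₂ u₃ u₄)
  | nil {s : V} {u v : 𝒢.Gv s} (h : 𝒢.Gv s) (eq : u = h * v * h⁻¹) : Traj 𝒢 s u s v
  | cons (a : E × Bool) {u : 𝒢.Gv (𝒢.graph.org a)} {t : V} {v : 𝒢.Gv t}
      (h : 𝒢.Gv (𝒢.graph.org a)) (c : 𝒢.Ge a.1) (eq : u = h * 𝒢.φ a c * h⁻¹)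
      (rest : Traj 𝒢 (𝒢.graph.ext a) (𝒢.φExt a c) t v) : Traj 𝒢 (𝒢.graph.org a) u t v

namespace Traj

variable {𝒢 : GraphOfGroups.{u₁, u₂, u₃, u₄} V E}

/-- The trajectory is trivial, i.e. its path has length `0`. -/
def IsTrivial : {s : V} → {u : 𝒢.Gv s} → {t : V} → {v : 𝒢.Gv t} → 𝒢.Traj s u t v → Prop
  | _, _, _, _, nil _ _ => True
  | _, _, _, _, cons _ _ _ _ _ => False

/-- The first edge of the trajectory is `b`, and its first conjugating element `h₀` lies in the
image `G_b⁻` of the edge group of `b`. -/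
def StartsIn (b : E × Bool) :
    {s : V} → {u : 𝒢.Gv s} → {t : V} → {v : 𝒢.Gv t} → 𝒢.Traj s u t v → Prop
  | _, _, _, _, nil _ _ => False
  | _, _, _, _, cons a h _ _ _ => a = b ∧ h ∈ (𝒢.φ a).range

/-- A trajectory is reduced if there is no `i` with `0 < i < n`, `aᵢ₊₁ = -aᵢ` and
`hᵢ ∈ G_{aᵢ}⁺ = G_{-aᵢ}⁻`. -/
def IsReduced : {s : V} → {u : 𝒢.Gv s} → {t : V} → {v : 𝒢.Gv t} → 𝒢.Traj s u t v → Prop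
  | _, _, _, _, nil _ _ => True
  | _, _, _, _, cons a _ _ _ rest => ¬ rest.StartsIn (inv a) ∧ rest.IsReduced

end Traj

/-- A graph of groups is without circuit if for every nontrivial element `u` of a vertex group,
every reduced circuit at `u` (a trajectory from `u` to `u` with equal origin and extremity)
is trivial. -/
def WithoutCircuit (𝒢 : GraphOfGroups.{u₁, u₂, u₃, u₄} V E) : Prop :=
  ∀ (s : V) (u : 𝒢.Gv s), u ≠ 1 → ∀ C : 𝒢.Traj s u s u, C.IsReduced → C.IsTrivial

end GraphOfGroups

/-! Elements of the fundamental group are represented by words along paths in X, and everything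
rests on comparing reduced words. Let K be the product of all vertex groups, and let H be a group
containing K and a stable letter for every edge, tree edges included, subject to the edge relations.
A Britton-type lemma holds there (`isHNN_baseHom_stable`). Tree edges are trivial in the fundamental
group but not in H; a potential τ on the vertices repairs this (`exists_isTransport`): a
homomorphism f to H sends each G_s to its conjugate by τ(s), and τ(s)⁻¹ f(x) τ(r) is the value of
any path word for x from s to r, up to a final factor from G_r.

If x commutes with u ≠ 1 in G_s, comparing ux and xu syllable by syllable turns a reduced word of x
into a reduced circuit at u (`exists_traj`). The circuit is trivial, so x lies in G_s.

If u is not elliptic, it is conjugate to a cyclically reduced word, whose powers are all reduced. An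
element of Z(u) carries some point of the resulting axis to the axis (`exists_val_take_of_commute`);
modulo powers of u this leaves finitely many pairs of positions. Two elements with the same pair
differ, up to powers of u, by an elliptic element commuting with u, which is 1 by the vertex case.
Hence ⟨u⟩ has finite index in Z(u). Moreover Z(u) is torsion-free, and a transfer argument shows
that it is cyclic. -/

namespace MultiHNN

/-! ### Reduced words over a base group with stable letters -/

open OrientedGraph

variable {E : Type u₁} {K : Type u₂} [Group K] {M : E → Type u₃} [∀ e, Group (M e)]

@[simp] theorem inv_inv_edge (a : E × Bool) : inv (inv a) = a := by
  obtain ⟨e, b⟩ := a; simp [inv]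

theorem inv_ne_self (a : E × Bool) : inv a ≠ a := by
  obtain ⟨e, b⟩ := a; cases b <;> simp [inv]

/-- The homomorphism `ψ (inv a)`, with domain the group of the edge `a`. -/
def opp (ψ : ∀ a : E × Bool, M a.1 →* K) (a : E × Bool) : M a.1 →* K := ψ (inv a)

theorem opp_mem_range (ψ : ∀ a : E × Bool, M a.1 →* K) (a : E × Bool) (c : M a.1) :
    opp ψ a c ∈ (ψ (inv a)).range := ⟨c, rfl⟩

theorem exists_opp_eq {ψ : ∀ a : E × Bool, M a.1 →* K} {a : E × Bool} {k : K}
    (hk : k ∈ (ψ (inv a)).range) : ∃ c : M a.1, opp ψ a c = k := hk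

/-- The relation between consecutive syllables of a reduced word: no cancellation
`t_a h t_{-a}` with `h` in the image of the edge group. -/
def NoPinch (ψ : ∀ a : E × Bool, M a.1 →* K) (p q : K × (E × Bool)) : Prop :=
  ¬ (q.2 = inv p.2 ∧ q.1 ∈ (ψ q.2).range)

/-- A word is reduced if it has no pinch. -/
def Reduced (ψ : ∀ a : E × Bool, M a.1 →* K) (l : List (K × (E × Bool))) : Prop :=
  l.IsChain (NoPinch ψ)

/-- The value of a word `g₁ t_{a₁} ⋯ gₙ t_{aₙ}`. -/
def val {H : Type*} [Group H] (j : K →* H) (t : E × Bool → H) (l : List (K × (E × Bool))) : H :=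
  (l.map fun p => j p.1 * t p.2).prod

section val

variable {H : Type*} [Group H] (j : K →* H) (t : E × Bool → H)

@[simp] theorem val_nil : val j t [] = 1 := rfl

@[simp] theorem val_cons (p : K × (E × Bool)) (l : List (K × (E × Bool))) :
    val j t (p :: l) = j p.1 * t p.2 * val j t l := by simp [val]

@[simp] theorem val_append (l m : List (K × (E × Bool))) :
    val j t (l ++ m) = val j t l * val j t m := by simp [val]

end val

/-- `j : K → H` and the elements `t a` of `H` satisfy the defining relations of the multiple
HNN extension, and equal reduced words have compatible first syllables. -/
structure IsHNN (ψ : ∀ a : E × Bool, M a.1 →* K) {H : Type*} [Group H] (j : K →* H)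
    (t : E × Bool → H) : Prop where
  t_inv : ∀ a, t (inv a) = (t a)⁻¹
  rel : ∀ a c, j (ψ a c) * t a = t a * j (opp ψ a c)
  injective : Function.Injective j
  eq_nil : ∀ {l x}, Reduced ψ l → val j t l = j x → l = []
  head : ∀ {g a l m} {x y : K}, Reduced ψ ((g, a) :: l) → Reduced ψ m →
    val j t ((g, a) :: l) * j x = val j t m * j y →
    ∃ h m', m = (h, a) :: m' ∧ g⁻¹ * h ∈ (ψ a).range

/-! ### Permutation action on normal forms -/

section construction

/-- Normal words. -/
inductive NWord (E : Type u₁) (K : Type u₂) : Type (max u₁ u₂)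
  | nil (g : K) : NWord E K
  | cons (r : K) (a : E × Bool) (w : NWord E K) : NWord E K

variable (ψ : ∀ a : E × Bool, M a.1 →* K)

open Classical in
/-- A representative of the coset of `k` modulo the image of `ψ a`. -/
noncomputable def rep (a : E × Bool) (k : K) : K :=
  -- The trivial coset must get the representative 1: cancellation of stable letters is detected by
  -- a syllable equal to 1.
  if k ∈ (ψ a).range then 1 else (QuotientGroup.mk k : K ⧸ (ψ a).range).out

theorem rep_inv_mul_mem (a : E × Bool) (k : K) : (rep ψ a k)⁻¹ * k ∈ (ψ a).range := by
  unfold rep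
  split_ifs with h
  · simp [h]
  · rw [← QuotientGroup.eq]; exact Quotient.out_eq _

theorem rep_mul (a : E × Bool) (k : K) (c : M a.1) : rep ψ a (k * ψ a c) = rep ψ a k := by
  have hc : ψ a c ∈ (ψ a).range := ⟨c, rfl⟩
  unfold rep
  rw [Subgroup.mul_mem_cancel_right _ hc]
  split_ifs
  · rfl
  · congr 1
    rw [QuotientGroup.eq]
    simp

theorem rep_eq_one_iff (a : E × Bool) (k : K) : rep ψ a k = 1 ↔ k ∈ (ψ a).range := by
  refine ⟨fun h => by simpa [h] using rep_inv_mul_mem ψ a k, fun h => by simp [rep, h]⟩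

/-- The element of the edge group with `k = rep a k * ψ a (rem a k)`. -/
noncomputable def rem (a : E × Bool) (k : K) : M a.1 := (rep_inv_mul_mem ψ a k).choose

theorem map_rem (a : E × Bool) (k : K) : ψ a (rem ψ a k) = (rep ψ a k)⁻¹ * k :=
  (rep_inv_mul_mem ψ a k).choose_spec

theorem rep_mul_map_rem (a : E × Bool) (k : K) : rep ψ a k * ψ a (rem ψ a k) = k := by
  simp [map_rem]

theorem rep_rep (a : E × Bool) (k : K) : rep ψ a (rep ψ a k) = rep ψ a k := by
  conv_rhs => rw [← rep_mul_map_rem ψ a k, rep_mul]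

theorem rep_eq_rep_iff (a : E × Bool) (k k' : K) :
    rep ψ a k = rep ψ a k' ↔ k⁻¹ * k' ∈ (ψ a).range := by
  constructor
  · intro h
    refine ⟨(rem ψ a k)⁻¹ * rem ψ a k', ?_⟩
    rw [map_mul, map_inv, map_rem, map_rem, h]; group
  · rintro ⟨c, hc⟩
    rw [← rep_mul ψ a k c, hc, mul_inv_cancel_left]

namespace NWord

/-- The word begins with the syllable `1 t_b`. -/
def Starts (b : E × Bool) : NWord E K → Prop
  | nil _ => False
  | cons r a _ => a = b ∧ r = 1

/-- The word is in normal form. -/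
def Normal : NWord E K → Prop
  | nil _ => True
  | cons r a w => rep ψ a r = r ∧ ¬ w.Starts (inv a) ∧ w.Normal

/-- The action of `K` on words. -/
noncomputable def act : K → NWord E K → NWord E K
  | g, nil h => nil (g * h)
  | g, cons r a w => cons (rep ψ a (g * r)) a (act (opp ψ a (rem ψ a (g * r))) w)

/-- The word without its first syllable. -/
def tail : NWord E K → NWord E K
  | nil h => nil h
  | cons _ _ w => w

open Classical in
/-- The action of the stable letter `t_a` on words. -/
noncomputable def push (a : E × Bool) (w : NWord E K) : NWord E K :=
  if w.Starts (inv a) then w.tail else cons 1 a w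

variable {ψ}

theorem Starts.eq {b : E × Bool} {w : NWord E K} (h : w.Starts b) : w = cons 1 b w.tail := by
  cases w with
  | nil => exact h.elim
  | cons r a w => obtain ⟨rfl, rfl⟩ := h; rfl

/-- The remainder passed to the next syllable lies in the image of the edge group of `inv a`.
Multiplying by it cannot change whether a syllable at `inv a` represents the trivial coset, so no
cancellation appears. -/
theorem Normal.act {w : NWord E K} (hw : w.Normal ψ) (g : K) : (w.act ψ g).Normal ψ := by
  induction w generalizing g with
  | nil => trivial
  | cons r a w ih =>
    obtain ⟨h1, h2, h3⟩ := hw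
    refine ⟨rep_rep ψ a _, ?_, ih h3 _⟩
    cases w with
    | nil => exact fun h => h
    | cons r' b w =>
      rintro ⟨rfl, h⟩
      refine h2 ⟨rfl, ?_⟩
      rw [rep_eq_one_iff, Subgroup.mul_mem_cancel_left _ (opp_mem_range ψ _ _)] at h
      rw [← h3.1, (rep_eq_one_iff ψ _ _).2 h]

theorem Normal.tail {w : NWord E K} (hw : w.Normal ψ) : w.tail.Normal ψ := by
  cases w with
  | nil => trivial
  | cons r a w => exact hw.2.2

theorem Normal.push {w : NWord E K} (hw : w.Normal ψ) (a : E × Bool) :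
    (w.push a).Normal ψ := by
  unfold NWord.push
  split_ifs with h
  · exact hw.tail
  · exact ⟨(rep_eq_one_iff ψ a 1).2 (one_mem _), h, hw⟩

theorem Normal.act_one (hψ : ∀ a, Function.Injective (ψ a)) {w : NWord E K}
    (hw : w.Normal ψ) : w.act ψ 1 = w := by
  induction w with
  | nil => simp [NWord.act]
  | cons r a w ih =>
    obtain ⟨h1, -, h3⟩ := hw
    have h4 : rem ψ a r = 1 := hψ a (by rw [map_rem, h1, map_one, inv_mul_cancel])
    simp only [NWord.act, one_mul, h1, h4, map_one, ih h3]

theorem act_mul (hψ : ∀ a, Function.Injective (ψ a)) (g g' : K) (w : NWord E K) :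
    w.act ψ (g * g') = (w.act ψ g').act ψ g := by
  induction w generalizing g g' with
  | nil => simp [NWord.act, mul_assoc]
  | cons r a w ih =>
    have h : g * g' * r = g * rep ψ a (g' * r) * ψ a (rem ψ a (g' * r)) := by
      rw [mul_assoc, mul_assoc, rep_mul_map_rem]
    have h1 : rep ψ a (g * g' * r) = rep ψ a (g * rep ψ a (g' * r)) := by rw [h, rep_mul]
    have h2 : rem ψ a (g * g' * r) =
        rem ψ a (g * rep ψ a (g' * r)) * rem ψ a (g' * r) := by
      apply hψ a
      rw [map_mul, map_rem, map_rem, map_rem, h1]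
      group
    simp only [NWord.act, h1, h2, map_mul, ih]

/-- If the first push cancels a syllable, normality prevents the remaining word from starting with
`1 t_a`, so the second push restores that syllable. -/
theorem Normal.push_push {w : NWord E K} (hw : w.Normal ψ) (a : E × Bool) :
    (w.push a).push (inv a) = w := by
  by_cases h : w.Starts (inv a)
  · have h1 : ¬ w.tail.Starts (inv (inv a)) := by
      rw [h.eq] at hw; exact hw.2.1
    have h2 : w.push a = w.tail := if_pos h
    rw [h2, NWord.push, if_neg h1, ← h.eq]
  · have h2 : w.push a = cons 1 a w := if_neg h
    rw [h2, NWord.push, if_pos]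
    · rfl
    · exact ⟨(inv_inv_edge a).symm, rfl⟩

theorem Normal.act_push (hψ : ∀ a, Function.Injective (ψ a)) {w : NWord E K}
    (hw : w.Normal ψ) (a : E × Bool) (c : M a.1) :
    (w.push a).act ψ (ψ a c) = (w.act ψ (opp ψ a c)).push a := by
  have key : ∀ (b : E × Bool) (d : M b.1) (w : NWord E K),
      (cons 1 b w).act ψ (ψ b d) = cons 1 b (w.act ψ (opp ψ b d)) := by
    intro b d w
    have h1 : rep ψ b (ψ b d) = 1 := (rep_eq_one_iff ψ b _).2 ⟨d, rfl⟩
    have h2 : rem ψ b (ψ b d) = d := hψ b (by rw [map_rem, h1]; simp)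
    simp only [NWord.act, mul_one, h1, h2]
  by_cases h : w.Starts (inv a)
  · obtain ⟨w', rfl⟩ : ∃ w', w = cons 1 (inv a) w' := ⟨_, h.eq⟩
    have h1 : (cons 1 (inv a) w').act ψ (opp ψ a c) = cons 1 (inv a) (w'.act ψ (ψ a c)) := by
      -- For a concrete sign, `inv (inv a)` reduces to `a`, so `key` applies to the edge `inv a`.
      obtain ⟨e, b⟩ := a
      cases b
      exacts [key (e, true) c w', key (e, false) c w']
    rw [h1, NWord.push, NWord.push, if_pos h, if_pos ⟨rfl, rfl⟩]
    rfl
  · have h' : ¬ (w.act ψ (opp ψ a c)).Starts (inv a) := by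
      cases w with
      | nil => exact fun h => h
      | cons r b w =>
        rintro ⟨rfl, h1⟩
        refine h ⟨rfl, ?_⟩
        rw [rep_eq_one_iff, Subgroup.mul_mem_cancel_left _ (opp_mem_range ψ _ _)] at h1
        rw [← hw.1, (rep_eq_one_iff ψ _ _).2 h1]
    rw [NWord.push, NWord.push, if_neg h, if_neg h', key]

end NWord

/-- Words in normal form. -/
def NormalForm : Type (max u₁ u₂) := {w : NWord E K // w.Normal ψ}

variable {ψ} (hψ : ∀ a, Function.Injective (ψ a))

/-- The action of the base group on normal forms. -/
noncomputable def baseHom : K →* Equiv.Perm (NormalForm ψ) where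
  toFun g :=
    { toFun w := ⟨w.1.act ψ g, w.2.act g⟩
      invFun w := ⟨w.1.act ψ g⁻¹, w.2.act g⁻¹⟩
      left_inv w := Subtype.ext (by
        change (w.1.act ψ g).act ψ g⁻¹ = w.1
        rw [← NWord.act_mul hψ, inv_mul_cancel, w.2.act_one hψ])
      right_inv w := Subtype.ext (by
        change (w.1.act ψ g⁻¹).act ψ g = w.1
        rw [← NWord.act_mul hψ, mul_inv_cancel, w.2.act_one hψ]) }
  map_one' := Equiv.ext fun w => Subtype.ext (w.2.act_one hψ)
  map_mul' g g' := Equiv.ext fun w => Subtype.ext (NWord.act_mul hψ g g' w.1)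

/-- The action of a stable letter on normal forms. -/
noncomputable def stable (ψ : ∀ a : E × Bool, M a.1 →* K) (a : E × Bool) :
    Equiv.Perm (NormalForm ψ) where
  toFun w := ⟨w.1.push a, w.2.push a⟩
  invFun w := ⟨w.1.push (inv a), w.2.push (inv a)⟩
  left_inv w := Subtype.ext (w.2.push_push a)
  right_inv w := Subtype.ext (by simpa using w.2.push_push (inv a))

/-- The normal form of an element of the base group. -/
def NormalForm.base (ψ : ∀ a : E × Bool, M a.1 →* K) (g : K) : NormalForm ψ :=
  ⟨.nil g, trivial⟩

theorem val_base_nil (l : List (K × (E × Bool))) (hl : l = []) (x : K) :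
    ((val (baseHom hψ) (stable ψ) l * baseHom hψ x) (NormalForm.base ψ 1)).1 = .nil x := by
  subst hl
  rw [val_nil, one_mul]
  exact congrArg NWord.nil (mul_one x)

/-- A reduced word applied to the base point never cancels, since a pinch is exactly what lets a
push cancel. The first edge and the coset of the first syllable can therefore be read off the
result. -/
theorem val_base_cons {g : K} {a : E × Bool} {l : List (K × (E × Bool))}
    (hl : Reduced ψ ((g, a) :: l)) (x : K) :
    ∃ w, ((val (baseHom hψ) (stable ψ) ((g, a) :: l) * baseHom hψ x)
      (NormalForm.base ψ 1)).1 = .cons (rep ψ a g) a w := by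
  have key : ∀ w : NormalForm ψ, ¬ w.1.Starts (inv a) →
      ∃ w', ((baseHom hψ g * stable ψ a) w).1 = .cons (rep ψ a g) a w' := by
    intro w hw
    have : (stable ψ a w).1 = .cons 1 a w.1 := if_neg hw
    refine ⟨w.1.act ψ (opp ψ a (rem ψ a g)), ?_⟩
    change (stable ψ a w).1.act ψ g = _
    rw [this]; simp [NWord.act]
  rw [val_cons, mul_assoc, Equiv.Perm.mul_apply]
  apply key
  cases l with
  | nil => rw [val_base_nil hψ [] rfl]; exact fun h => h
  | cons p l =>
    obtain ⟨h, b⟩ := p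
    obtain ⟨h1, h2⟩ := List.isChain_cons_cons.1 hl
    obtain ⟨w, hw⟩ := val_base_cons h2 x
    rw [hw]
    rintro ⟨rfl, h3⟩
    exact h1 ⟨rfl, (rep_eq_one_iff ψ _ _).1 h3⟩

theorem isHNN_baseHom_stable : IsHNN ψ (baseHom hψ) (stable ψ) where
  t_inv a := Equiv.ext fun w => rfl
  rel a c := Equiv.ext fun w => Subtype.ext (w.2.act_push hψ a c)
  injective x y h := by
    have h1 := val_base_nil hψ [] rfl x
    rw [h, val_base_nil hψ [] rfl y] at h1
    exact (NWord.nil.inj h1).symm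
  eq_nil {l x} hl h := by
    cases l with
    | nil => rfl
    | cons p l =>
      obtain ⟨w, hw⟩ := val_base_cons hψ hl 1
      have h1 := val_base_nil hψ [] rfl x
      rw [map_one, mul_one, h] at hw
      rw [val_nil, one_mul, hw] at h1
      cases h1
  head {g a l m x y} hl hm h := by
    obtain ⟨w, hw⟩ := val_base_cons hψ hl x
    cases m with
    | nil =>
      rw [h, val_base_nil hψ [] rfl] at hw
      cases hw
    | cons p m =>
      obtain ⟨g', b⟩ := p
      obtain ⟨w', hw'⟩ := val_base_cons hψ hm y
      rw [h, hw'] at hw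
      injection hw with h1 h2 h3
      subst h2
      exact ⟨g', m, rfl, (rep_eq_rep_iff ψ _ _ _).1 h1.symm⟩

end construction

/-! ### Comparison and products of reduced words -/

section

variable {ψ : ∀ a : E × Bool, M a.1 →* K} {H : Type*} [Group H] {j : K →* H} {t : E × Bool → H}

/-- Left multiplication of the first syllable of a word. -/
def lmul (k : K) : List (K × (E × Bool)) → List (K × (E × Bool))
  | [] => []
  | (h, b) :: l => (k * h, b) :: l

theorem length_lmul (k : K) (l : List (K × (E × Bool))) :
    (lmul k l).length = l.length := by
  cases l <;> rfl

theorem Reduced.lmul {l : List (K × (E × Bool))} (hl : Reduced ψ l) (k : K) :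
    Reduced ψ (lmul k l) := by
  cases l with
  | nil => exact hl
  | cons p l => exact List.IsChain.imp_head (x := p) (y := (k * p.1, p.2)) (fun h => h) hl

theorem val_lmul (k : K) (l : List (K × (E × Bool))) :
    ∃ x : K, val j t (lmul k l) * j x = j k * val j t l := by
  cases l with
  | nil => exact ⟨k, by simp [lmul]⟩
  | cons p l => exact ⟨1, by simp [lmul, mul_assoc]⟩

namespace IsHNN

/-- Two reduced words with values equal modulo the base group on both sides have the same
length, and their prefixes have the same property. -/
theorem take_eq (hH : IsHNN ψ j t) {l m : List (K × (E × Bool))} (hl : Reduced ψ l)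
    (hm : Reduced ψ m) {k x y : K} (h : val j t l * j x = j k * val j t m * j y) :
    l.length = m.length ∧
      ∀ i, ∃ z, val j t (l.take i) * j z = j k * val j t (m.take i) := by
  induction l generalizing m k with
  | nil =>
    have h1 : val j t m = j (k⁻¹ * x * y⁻¹) := by
      simp only [map_mul, map_inv]
      rw [eq_mul_inv_iff_mul_eq, eq_comm, inv_mul_eq_iff_eq_mul]
      simpa [mul_assoc] using h
    obtain rfl := hH.eq_nil hm h1
    exact ⟨rfl, fun i => ⟨k, by simp⟩⟩
  | cons p l ih =>
    obtain ⟨g, a⟩ := p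
    obtain ⟨x', hx'⟩ := val_lmul (j := j) (t := t) k m
    obtain ⟨h', m', hm', c, hc⟩ := hH.head hl (hm.lmul k) (x := x) (y := x' * y) (by
      rw [h, map_mul, ← mul_assoc, hx'])
    obtain ⟨h₀, rfl, rfl⟩ : ∃ h₀, m = (h₀, a) :: m' ∧ h' = k * h₀ := by
      cases m with
      | nil => cases hm'
      | cons q m =>
        simp only [lmul, List.cons.injEq, Prod.mk.injEq] at hm'
        obtain ⟨⟨h1, h2⟩, h3⟩ := hm'
        exact ⟨q.1, by rw [← h2, ← h3], h1.symm⟩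
    -- The two first syllables differ by an edge group element; moved across `t a`, it becomes the
    -- new left factor `k` for the tails.
    have hk : j k * j h₀ * t a = j g * t a * j (opp ψ a c) := by
      rw [mul_assoc (j g), ← hH.rel, ← mul_assoc, ← map_mul, ← map_mul, hc, mul_inv_cancel_left]
    have hE : val j t l * j x = j (opp ψ a c) * val j t m' * j y := by
      simp only [val_cons] at h
      rw [← mul_assoc, ← mul_assoc, hk] at h
      simpa [mul_assoc] using h
    obtain ⟨h1, h2⟩ := ih hl.tail hm.tail hE
    refine ⟨by simp [h1], fun i => ?_⟩
    cases i with
    | zero => exact ⟨k, by simp⟩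
    | succ i =>
      obtain ⟨z, hz⟩ := h2 i
      refine ⟨z, ?_⟩
      simp only [List.take_succ_cons, val_cons]
      rw [← mul_assoc, ← mul_assoc, hk, mul_assoc, hz]
      simp [mul_assoc]

/-- The reduced form of a product of two reduced words. -/
theorem exists_reduced_append (hH : IsHNN ψ j t) {l m : List (K × (E × Bool))}
    (hl : Reduced ψ l) (hm : Reduced ψ m) (k : K) :
    ∃ i k', i ≤ l.length ∧ i ≤ m.length ∧
      Reduced ψ (l.take (l.length - i) ++ lmul k' (m.drop i)) ∧
      val j t l * j k * val j t (m.take i) = val j t (l.take (l.length - i)) * j k' := by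
  induction l using List.reverseRecOn generalizing m k with
  | nil => exact ⟨0, k, by simp, by simp, by simpa using hm.lmul k, by simp⟩
  | append_singleton l p ih =>
    by_cases hr : Reduced ψ ((l ++ [p]) ++ lmul k m)
    · refine ⟨0, k, by simp, by simp, ?_, ?_⟩
      · rwa [Nat.sub_zero, List.take_length, List.drop_zero]
      · rw [Nat.sub_zero, List.take_length, List.take_zero, val_nil, mul_one]
    obtain ⟨g, a⟩ := p
    cases m with
    | nil => exact (hr (by simpa [lmul] using hl)).elim
    | cons q m =>
      obtain ⟨h, b⟩ := q
      have : ¬ NoPinch ψ (g, a) (k * h, b) := by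
        intro hn
        refine hr (List.IsChain.append hl (hm.lmul k) ?_)
        simpa [lmul] using hn
      obtain ⟨hb, hc⟩ := not_not.1 this
      dsimp only at hb hc
      subst hb
      obtain ⟨c, hc⟩ := exists_opp_eq hc
      -- The pinch collapses to `ψ a c`, which joins `g` as the middle factor between the shortened
      -- words.
      obtain ⟨i, k', h1, h2, h3, h4⟩ := ih (List.IsChain.left_of_append hl) hm.tail (g * ψ a c)
      refine ⟨i + 1, k', by simpa using h1, by simpa using h2, ?_, ?_⟩
      · rw [List.take_append_of_le_length (by simp)]
        simpa using h3
      · rw [List.take_append_of_le_length (by simp)]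
        simp only [List.length_append, List.length_singleton, Nat.add_sub_add_right,
          List.take_succ_cons, val_cons, val_append, val_nil, mul_one]
        rw [← h4, hH.t_inv, map_mul j g]
        have h5 : j (ψ a c) = t a * (j k * j h) * (t a)⁻¹ := by
          rw [← map_mul, ← hc, eq_mul_inv_iff_mul_eq, hH.rel]
        rw [h5]
        simp [mul_assoc]

end IsHNN

end

end MultiHNN

/-! ### Path words in the fundamental group -/

namespace GraphOfGroups

open OrientedGraph MultiHNN

variable {V : Type u₁} {E : Type u₂} (𝒢 : GraphOfGroups.{u₁, u₂, u₃, u₄} V E) (T : Set E)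

open Classical in
/-- The embedding of a vertex group in the product of all the vertex groups. -/
noncomputable def emb (s : V) : 𝒢.Gv s →* ∀ s, 𝒢.Gv s := MonoidHom.mulSingle 𝒢.Gv s

theorem emb_injective (s : V) : Function.Injective (𝒢.emb s) := by
  classical
  exact Pi.mulSingle_injective s

/-- The edge groups as subgroups of the product of all the vertex groups. -/
noncomputable def edgeEmb (a : E × Bool) : 𝒢.Ge a.1 →* ∀ s, 𝒢.Gv s :=
  (𝒢.emb (𝒢.graph.org a)).comp (𝒢.φ a)

theorem edgeEmb_injective (a : E × Bool) : Function.Injective (𝒢.edgeEmb a) :=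
  (𝒢.emb_injective _).comp (𝒢.φ_injective a)

theorem edgeEmb_apply (a : E × Bool) (c : 𝒢.Ge a.1) :
    𝒢.edgeEmb a c = 𝒢.emb _ (𝒢.φ a c) := rfl

theorem opp_edgeEmb (a : E × Bool) (c : 𝒢.Ge a.1) :
    opp 𝒢.edgeEmb a c = 𝒢.emb _ (𝒢.φExt a c) := rfl

theorem ext_inv (a : E × Bool) : 𝒢.graph.ext (inv a) = 𝒢.graph.org a := by
  simp [OrientedGraph.ext]

/-- The element of the fundamental group defined by an edge. -/
def edge (a : E × Bool) : 𝒢.Pi1 T := QuotientGroup.mk' _ (𝒢.freeEdge a)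

variable {𝒢 T}

theorem edge_inv (a : E × Bool) : 𝒢.edge T (inv a) = (𝒢.edge T a)⁻¹ := by
  rw [eq_inv_iff_mul_eq_one, edge, edge, ← map_mul]
  exact (QuotientGroup.eq_one_iff _).2 (Subgroup.subset_normalClosure (.inl (.inr ⟨a, rfl⟩)))

theorem edge_eq_one {a : E × Bool} (ha : a.1 ∈ T) : 𝒢.edge T a = 1 :=
  (QuotientGroup.eq_one_iff _).2 (Subgroup.subset_normalClosure (.inr ⟨a, ha, rfl⟩))

theorem vertexHom_mul_edge (a : E × Bool) (c : 𝒢.Ge a.1) :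
    𝒢.vertexHom T _ (𝒢.φ a c) * 𝒢.edge T a = 𝒢.edge T a * 𝒢.vertexHom T _ (𝒢.φExt a c) := by
  have key : ∀ (e : E) (c : 𝒢.Ge e), 𝒢.vertexHom T _ (𝒢.φ (e, true) c) * 𝒢.edge T (e, true) =
      𝒢.edge T (e, true) * 𝒢.vertexHom T _ (𝒢.φExt (e, true) c) := by
    intro e c
    have h : QuotientGroup.mk' (Subgroup.normalClosure (𝒢.relators T)) _ = 1 :=
      (QuotientGroup.eq_one_iff _).2 (Subgroup.subset_normalClosure (.inl (.inl ⟨e, c, rfl⟩)))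
    simp only [map_mul, map_inv] at h
    rw [mul_inv_eq_one, eq_mul_inv_iff_mul_eq] at h
    exact h
  obtain ⟨e, b⟩ := a
  cases b
  · have h1 : 𝒢.edge T (e, false) = (𝒢.edge T (e, true))⁻¹ := edge_inv (e, true)
    rw [h1, eq_inv_mul_iff_mul_eq, ← mul_assoc, mul_inv_eq_iff_eq_mul]
    exact (key e c).symm
  · exact key e c

/-- `Rep s r l x`: the word `l` describes a path from `s` to `r` and represents `x` up to right
multiplication by an element of the vertex subgroup of `r`. -/
def Rep : V → V → List ((∀ s, 𝒢.Gv s) × (E × Bool)) → 𝒢.Pi1 T → Prop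
  | s, r, [], x => ∃ g : 𝒢.Gv s, s = r ∧ x = 𝒢.vertexHom T s g
  | s, r, (k, a) :: l, x => ∃ (g : 𝒢.Gv s) (y : 𝒢.Pi1 T), 𝒢.graph.org a = s ∧ k = 𝒢.emb s g ∧
      Rep (𝒢.graph.ext a) r l y ∧ x = 𝒢.vertexHom T s g * 𝒢.edge T a * y

namespace Rep

variable {s r q : V} {l m : List ((∀ s, 𝒢.Gv s) × (E × Bool))} {x y : 𝒢.Pi1 T}

theorem lmul (h : Rep s r l x) (g : 𝒢.Gv s) :
    Rep s r (MultiHNN.lmul (𝒢.emb s g) l) (𝒢.vertexHom T s g * x) := by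
  cases l with
  | nil =>
    obtain ⟨g', rfl, rfl⟩ := h
    exact ⟨g * g', rfl, (map_mul _ _ _).symm⟩
  | cons p l =>
    obtain ⟨g', y, h1, h2, h3, rfl⟩ := h
    exact ⟨g * g', y, h1, by rw [h2, map_mul], h3, by simp [mul_assoc]⟩

/-- The final vertex element of the first word, which the list does not record, is absorbed by the
first syllable of the second. -/
theorem append (h : Rep s r l x) (h' : Rep r q m y) :
    ∃ g : 𝒢.Gv r, Rep s q (l ++ MultiHNN.lmul (𝒢.emb r g) m) (x * y) := by
  induction l generalizing s x with
  | nil =>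
    obtain ⟨g, rfl, rfl⟩ := h
    exact ⟨g, h'.lmul g⟩
  | cons p l ih =>
    obtain ⟨g', z, h1, h2, h3, rfl⟩ := h
    obtain ⟨g, hg⟩ := ih h3
    exact ⟨g, g', z * y, h1, h2, hg, by simp [mul_assoc]⟩

theorem exists_take (h : Rep s r l x) (i : ℕ) :
    ∃ (q : V) (y : 𝒢.Pi1 T), Rep s q (l.take i) y := by
  induction l generalizing s x i with
  | nil => exact ⟨s, 1, by rw [List.take_nil]; exact ⟨1, rfl, (map_one _).symm⟩⟩
  | cons p l ih =>
    cases i with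
    | zero => exact ⟨s, 1, 1, rfl, (map_one _).symm⟩
    | succ i =>
      obtain ⟨g', z, h1, h2, h3, rfl⟩ := h
      obtain ⟨q, y, hy⟩ := ih h3 i
      exact ⟨q, _, g', y, h1, h2, hy, rfl⟩

theorem of_isPath {p : List (E × Bool)} (h : 𝒢.graph.IsPath s p r) (hp : ∀ a ∈ p, a.1 ∈ T) :
    Rep s r (p.map fun a => ((1 : ∀ s, 𝒢.Gv s), a)) (1 : 𝒢.Pi1 T) := by
  induction p generalizing s with
  | nil => exact ⟨1, h, by simp⟩
  | cons a p ih =>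
    refine ⟨1, 1, h.1, by simp, ih h.2 fun b hb => hp b (List.mem_cons_of_mem _ hb), ?_⟩
    simp [edge_eq_one (𝒢 := 𝒢) (hp a List.mem_cons_self)]

theorem exists_shorter (h : Rep s r l x) (hl : ¬ Reduced 𝒢.edgeEmb l) :
    ∃ l', Rep s r l' x ∧ l'.length < l.length := by
  induction l generalizing s x with
  | nil => exact (hl .nil).elim
  | cons p l ih =>
    obtain ⟨k, a⟩ := p
    obtain ⟨g, y, rfl, rfl, h3, rfl⟩ := h
    by_cases hr : Reduced 𝒢.edgeEmb l
    · cases l with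
      | nil => exact (hl (.singleton _)).elim
      | cons p l =>
        obtain ⟨k', b⟩ := p
        have : ¬ NoPinch 𝒢.edgeEmb (𝒢.emb _ g, a) (k', b) :=
          fun hn => hl (List.isChain_cons_cons.2 ⟨hn, hr⟩)
        obtain ⟨hb, hc⟩ := not_not.1 this
        dsimp only at hb hc
        subst hb
        obtain ⟨c, rfl⟩ := exists_opp_eq hc
        obtain ⟨g', z, -, h4, h5, rfl⟩ := h3
        rw [opp_edgeEmb] at h4
        obtain rfl := 𝒢.emb_injective _ h4
        rw [ext_inv] at h5
        refine ⟨_, h5.lmul (g * 𝒢.φ a c) |> cast (congrArg _ ?_), ?_⟩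
        · rw [edge_inv, ← mul_assoc, ← mul_assoc, mul_assoc _ (𝒢.edge T a),
            ← vertexHom_mul_edge, map_mul]
          simp [mul_assoc]
        · rw [length_lmul]; simp
    · obtain ⟨l', h1, h2⟩ := ih h3 hr
      exact ⟨(_, a) :: l', ⟨g, y, rfl, rfl, h1, rfl⟩, by simpa using h2⟩

theorem exists_reduced (h : Rep s r l x) :
    ∃ l', Rep s r l' x ∧ Reduced 𝒢.edgeEmb l' ∧ l'.length ≤ l.length := by
  induction hn : l.length using Nat.strong_induction_on generalizing l with
  | h n ih =>
    by_cases hl : Reduced 𝒢.edgeEmb l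
    · exact ⟨l, h, hl, hn.le⟩
    · obtain ⟨l', h1, h2⟩ := h.exists_shorter hl
      obtain ⟨m, h3, h4, h5⟩ := ih _ (hn ▸ h2) h1 rfl
      exact ⟨m, h3, h4, h5.trans (hn ▸ h2.le)⟩

end Rep

/-- Induction on the generators of the fundamental group. -/
theorem Pi1.induction {p : 𝒢.Pi1 T → Prop} (one : p 1) (mul : ∀ x y, p x → p y → p (x * y))
    (vertex : ∀ s g, p (𝒢.vertexHom T s g)) (edge : ∀ a, p (𝒢.edge T a)) (x : 𝒢.Pi1 T) :
    p x := by
  obtain ⟨x, rfl⟩ := QuotientGroup.mk'_surjective _ x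
  induction x using Monoid.Coprod.induction_on with
  | inl x =>
    induction x using Monoid.CoprodI.induction_on with
    | one => simpa using one
    | of s g => exact vertex s g
    | mul x y hx hy => rw [map_mul, map_mul]; exact mul _ _ hx hy
  | inr x =>
    induction x using FreeGroup.induction_on with
    | C1 => simpa using one
    | of a => exact edge a
    | inv_of a _ =>
      rw [map_inv, map_inv]
      have h := edge (inv a)
      rw [edge_inv] at h
      exact h
    | mul x y hx hy => rw [map_mul, map_mul]; exact mul _ _ hx hy
  | mul x y hx hy => rw [map_mul]; exact mul _ _ hx hy

theorem exists_rep (hT : 𝒢.graph.IsMaximalTree T) (x : 𝒢.Pi1 T) (s r : V) :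
    ∃ l, Rep s r l x := by
  have one : ∀ s r : V, ∃ l, Rep s r l (1 : 𝒢.Pi1 T) := fun s r => by
    obtain ⟨p, ⟨h1, -, h2⟩, -⟩ := hT s r
    exact ⟨_, Rep.of_isPath h1 h2⟩
  have mul : ∀ {x y : 𝒢.Pi1 T} {s r q : V}, (∃ l, Rep s r l x) → (∃ l, Rep r q l y) →
      ∃ l, Rep s q l (x * y) := by
    rintro x y s r q ⟨l, hl⟩ ⟨m, hm⟩
    obtain ⟨g, hg⟩ := hl.append hm
    exact ⟨_, hg⟩
  induction x using Pi1.induction generalizing s r with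
  | one => exact one s r
  | mul x y hx hy => exact mul (hx s s) (hy s r)
  | vertex q g =>
    have := mul (mul (one s q) ⟨[], g, rfl, rfl⟩) (one q r)
    simpa using this
  | edge a =>
    have h : ∃ l, Rep (𝒢.graph.org a) (𝒢.graph.ext a) l (𝒢.edge T a) :=
      ⟨[(1, a)], 1, 1, rfl, by simp, ⟨1, rfl, by simp⟩, by simp⟩
    have := mul (mul (one s _) h) (one _ r)
    simpa using this

/-! ### Transport to the multiple HNN extension -/

/-- `ρ s r x` is the value in a multiple HNN extension of the words for `x` along the paths
from `s` to `r`. -/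
structure IsTransport {H : Type*} [Group H] (j : (∀ s, 𝒢.Gv s) →* H) (t : E × Bool → H)
    (ρ : V → V → 𝒢.Pi1 T → H) : Prop where
  isHNN : IsHNN 𝒢.edgeEmb j t
  mul : ∀ s r q x y, ρ s q (x * y) = ρ s r x * ρ r q y
  vertex : ∀ s g, ρ s s (𝒢.vertexHom T s g) = j (𝒢.emb s g)
  edge : ∀ a, ρ (𝒢.graph.org a) (𝒢.graph.ext a) (𝒢.edge T a) = t a

theorem isPath_append {X : OrientedGraph V E} {s r q : V} {l m : List (E × Bool)}
    (h : X.IsPath s l r) (h' : X.IsPath r m q) : X.IsPath s (l ++ m) q := by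
  induction l generalizing s with
  | nil => obtain rfl := h; exact h'
  | cons a l ih => exact ⟨h.1, ih h.2⟩

theorem isPath_append_singleton {X : OrientedGraph V E} {s r : V} {l : List (E × Bool)}
    {a : E × Bool} (h : X.IsPath s (l ++ [a]) r) : X.IsPath s l (X.org a) ∧ r = X.ext a := by
  induction l generalizing s with
  | nil => exact ⟨h.1.symm, h.2.symm⟩
  | cons b l ih => exact ⟨⟨h.1, (ih h.2).1⟩, (ih h.2).2⟩

/-- In a maximal tree, vertices have potentials whose differences along edges are prescribed. -/
theorem exists_potential {H : Type*} [Group H] {X : OrientedGraph V E} (hT : X.IsMaximalTree T)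
    {t : E × Bool → H} (ht : ∀ a, t (inv a) = (t a)⁻¹) :
    ∃ τ : V → H, ∀ a, a.1 ∈ T → τ (X.ext a) = τ (X.org a) * t a := by
  rcases isEmpty_or_nonempty V with hV | ⟨⟨s₀⟩⟩
  · exact ⟨fun _ => 1, fun a => isEmptyElim (X.org a)⟩
  choose P hP hu using fun r => hT s₀ r
  refine ⟨fun r => ((P r).map t).prod, fun a ha => ?_⟩
  have key : ∀ a : E × Bool, a.1 ∈ T → IsReducedPath (P (X.org a) ++ [a]) →
      P (X.ext a) = P (X.org a) ++ [a] := by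
    intro a ha hr
    refine (hu _ _ ⟨isPath_append (hP _).1 (show X.IsPath _ [a] _ from ⟨rfl, rfl⟩), hr, ?_⟩).symm
    intro b hb
    rcases List.mem_append.1 hb with hb | hb
    · exact (hP _).2.2 b hb
    · rw [List.mem_singleton.1 hb]; exact ha
  -- By uniqueness of tree paths from `s₀`, the path to one end of `a` is the path to the other
  -- followed by `a` or `inv a`.
  by_cases hr : IsReducedPath (P (X.org a) ++ [a])
  · simp [key a ha hr]
  · obtain ⟨l, hl⟩ : ∃ l, P (X.org a) = l ++ [inv a] := by
      rcases List.eq_nil_or_concat' (P (X.org a)) with h | ⟨l, b, h⟩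
      · exact (hr (by rw [h]; exact .singleton a)).elim
      · refine ⟨l, ?_⟩
        rw [h]
        by_contra hb
        refine hr (List.IsChain.append (hP _).2.1 (.singleton a) ?_)
        rw [h]
        simp only [List.getLast?_append, List.getLast?_singleton, Option.some_or,
          Option.mem_def, Option.some.injEq, List.head?_cons, forall_eq']
        rintro rfl
        exact hb (by simp)
    obtain ⟨h1, h2, h3⟩ := hP (X.org a)
    rw [hl] at h1 h2 h3
    have h4 : P (X.ext a) = l :=
      (hu _ _ ⟨(isPath_append_singleton h1).1, List.IsChain.left_of_append h2,
        fun b hb => h3 b (List.mem_append_left _ hb)⟩).symm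
    simp [hl, h4, ht]

theorem exists_isTransport (hT : 𝒢.graph.IsMaximalTree T) :
    ∃ (H : Type (max u₁ u₂ u₃)) (_ : Group H) (j : (∀ s, 𝒢.Gv s) →* H) (t : E × Bool → H)
      (ρ : V → V → 𝒢.Pi1 T → H), IsTransport j t ρ := by
  obtain ⟨H, _, j, t, hH⟩ : ∃ (H : Type (max u₁ u₂ u₃)) (_ : Group H)
      (j : (∀ s, 𝒢.Gv s) →* H) (t : E × Bool → H), IsHNN 𝒢.edgeEmb j t :=
    ⟨_, _, _, _, isHNN_baseHom_stable 𝒢.edgeEmb_injective⟩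
  obtain ⟨τ, hτ⟩ := exists_potential hT hH.t_inv
  let F : 𝒢.FreeProd →* H := Monoid.Coprod.lift
    (Monoid.CoprodI.lift fun s => (MulAut.conj (τ s)).toMonoidHom.comp (j.comp (𝒢.emb s)))
    (FreeGroup.lift fun a => τ (𝒢.graph.org a) * t a * (τ (𝒢.graph.ext a))⁻¹)
  have hFv : ∀ s g, F (𝒢.freeVertex s g) = τ s * j (𝒢.emb s g) * (τ s)⁻¹ := by
    intro s g; simp [F, freeVertex]
  have hFe : ∀ a, F (𝒢.freeEdge a) = τ (𝒢.graph.org a) * t a * (τ (𝒢.graph.ext a))⁻¹ := by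
    intro a; simp [F, freeEdge]
  have hF : Subgroup.normalClosure (𝒢.relators T) ≤ F.ker := by
    refine Subgroup.normalClosure_le_normal ?_
    rintro _ ((⟨e, h, rfl⟩ | ⟨a, rfl⟩) | ⟨a, ha, rfl⟩)
    · have h1 := hH.rel (e, true) h
      rw [opp_edgeEmb, edgeEmb_apply] at h1
      simp only [SetLike.mem_coe, MonoidHom.mem_ker, map_mul, map_inv, hFv, hFe]
      rw [mul_inv_eq_one]
      rw [← eq_mul_inv_iff_mul_eq] at h1
      rw [h1]
      simp [mul_assoc]
    · simp only [SetLike.mem_coe, MonoidHom.mem_ker, map_mul, hFe, ext_inv, hH.t_inv]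
      change τ (𝒢.graph.ext a) * _ * _ * _ = 1
      simp [mul_assoc]
    · simp only [SetLike.mem_coe, MonoidHom.mem_ker, hFe, hτ a ha]
      simp
  let f : 𝒢.Pi1 T →* H := QuotientGroup.lift _ F hF
  -- Undoing the twist by τ at both ends restores the untwisted values of vertex elements and edges.
  refine ⟨H, _, j, t, fun s r x => (τ s)⁻¹ * f x * τ r, hH, ?_, ?_, ?_⟩
  · intro s r q x y
    simp [mul_assoc]
  · intro s g
    have : f (𝒢.vertexHom T s g) = F (𝒢.freeVertex s g) := rfl
    simp [this, hFv, mul_assoc]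
  · intro a
    have : f (𝒢.edge T a) = F (𝒢.freeEdge a) := rfl
    simp [this, hFe, mul_assoc]

end GraphOfGroups

/-! ### Circuits and centralizers of vertex elements -/

namespace GraphOfGroups

open OrientedGraph MultiHNN

variable {V : Type u₁} {E : Type u₂} {𝒢 : GraphOfGroups.{u₁, u₂, u₃, u₄} V E} {T : Set E}

namespace IsTransport

variable {H : Type*} [Group H] {j : (∀ s, 𝒢.Gv s) →* H} {t : E × Bool → H}
  {ρ : V → V → 𝒢.Pi1 T → H} (hρ : IsTransport j t ρ)

include hρ

theorem map_one (s : V) : ρ s s 1 = 1 := by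
  have := hρ.vertex s 1
  simpa using this

theorem exists_eq {s r : V} {l : List ((∀ s, 𝒢.Gv s) × (E × Bool))} {x : 𝒢.Pi1 T}
    (h : Rep s r l x) : ∃ g : 𝒢.Gv r, ρ s r x = val j t l * j (𝒢.emb r g) := by
  induction l generalizing s x with
  | nil =>
    obtain ⟨g, rfl, rfl⟩ := h
    exact ⟨g, by simp [hρ.vertex]⟩
  | cons p l ih =>
    obtain ⟨k, a⟩ := p
    obtain ⟨g, y, rfl, rfl, h3, rfl⟩ := h
    obtain ⟨g', hg'⟩ := ih h3
    refine ⟨g', ?_⟩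
    rw [hρ.mul _ _ _ _ y, hρ.mul _ _ _ _ (𝒢.edge T a), hρ.vertex, hρ.edge, hg']
    simp [mul_assoc]

theorem vertexHom_injective (s : V) : Function.Injective (𝒢.vertexHom T s) := by
  intro g h hgh
  apply 𝒢.emb_injective s
  apply hρ.isHNN.injective
  rw [← hρ.vertex, ← hρ.vertex, hgh]

/-- The map to the multiple HNN extension as a homomorphism. -/
def toHom (s : V) : 𝒢.Pi1 T →* H where
  toFun := ρ s s
  map_one' := hρ.map_one s
  map_mul' := hρ.mul s s s

/-- An element whose value lies in the base group lies in the vertex subgroup. -/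
theorem exists_vertexHom_eq (hT : 𝒢.graph.IsMaximalTree T) {s : V} {x : 𝒢.Pi1 T}
    {k : ∀ s, 𝒢.Gv s} (h : ρ s s x = j k) : ∃ g, x = 𝒢.vertexHom T s g := by
  obtain ⟨l, hl⟩ := exists_rep hT x s s
  obtain ⟨m, hm, hr, -⟩ := hl.exists_reduced
  obtain ⟨g, hg⟩ := hρ.exists_eq hm
  have h : val j t m = j (k * (𝒢.emb s g)⁻¹) := by
    rw [map_mul, map_inv, eq_mul_inv_iff_mul_eq, ← hg, h]
  obtain rfl := hρ.isHNN.eq_nil hr h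
  obtain ⟨g', -, rfl⟩ := hm
  exact ⟨g', rfl⟩

/-- A reduced word intertwining elements of two vertex groups defines a reduced trajectory. -/
theorem exists_traj {s r : V} {l : List ((∀ s, 𝒢.Gv s) × (E × Bool))} {x : 𝒢.Pi1 T}
    (h : Rep s r l x) (hl : Reduced 𝒢.edgeEmb l) {u : 𝒢.Gv s} {v : 𝒢.Gv r}
    (huv : j (𝒢.emb s u) * ρ s r x = ρ s r x * j (𝒢.emb r v)) :
    ∃ C : 𝒢.Traj s u r v, C.IsReduced ∧ (C.IsTrivial → l = []) ∧
      ∀ b, C.StartsIn b → ∃ k l', l = (k, b) :: l' ∧ k ∈ (𝒢.edgeEmb b).range := by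
  induction l generalizing s x with
  | nil =>
    obtain ⟨g, rfl, rfl⟩ := h
    rw [hρ.vertex, ← map_mul, ← map_mul, ← map_mul, ← map_mul] at huv
    have := 𝒢.emb_injective _ (hρ.isHNN.injective huv)
    have hu : u = g * v * g⁻¹ := by rw [← this, mul_inv_cancel_right]
    exact ⟨.nil g hu, trivial, fun _ => rfl, fun _ h => h.elim⟩
  | cons p l ih =>
    obtain ⟨k, a⟩ := p
    obtain ⟨g, y, rfl, rfl, h3, rfl⟩ := h
    obtain ⟨g', hg'⟩ := hρ.exists_eq h3
    rw [hρ.mul _ _ _ _ y, hρ.mul _ _ _ _ (𝒢.edge T a), hρ.vertex, hρ.edge] at huv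
    have hl' : Reduced 𝒢.edgeEmb ((𝒢.emb _ u * 𝒢.emb _ g, a) :: l) := hl.lmul (𝒢.emb _ u)
    -- Comparing the first syllables `u g` and `g` shows that `g⁻¹ u⁻¹ g` comes from the edge group;
    -- hence the inverse of `c` in the trajectory.
    obtain ⟨k', l', hk, c, hc⟩ := hρ.isHNN.head (x := 𝒢.emb r g') (y := 𝒢.emb r g' * 𝒢.emb r v)
      hl' hl (by
        rw [hg'] at huv
        simpa [mul_assoc] using huv)
    obtain ⟨rfl, rfl⟩ : 𝒢.emb _ g = k' ∧ l = l' := by simpa using hk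
    have hc' : u = g * 𝒢.φ a c⁻¹ * g⁻¹ := by
      apply 𝒢.emb_injective
      rw [edgeEmb_apply] at hc
      rw [map_mul, map_mul, map_inv, map_inv, map_inv, hc]
      group
    have hrel := hρ.isHNN.rel a c⁻¹
    rw [opp_edgeEmb, edgeEmb_apply] at hrel
    have hgu : j (𝒢.emb _ g) * j (𝒢.emb _ (𝒢.φ a c⁻¹)) = j (𝒢.emb _ u) * j (𝒢.emb _ g) := by
      conv_rhs => rw [hc']
      simp
    have hy : j (𝒢.emb _ (𝒢.φExt a c⁻¹)) * ρ (𝒢.graph.ext a) r y =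
        ρ (𝒢.graph.ext a) r y * j (𝒢.emb r v) := by
      apply mul_left_cancel (a := t a)
      rw [← mul_assoc, ← hrel]
      apply mul_left_cancel (a := j (𝒢.emb _ g))
      rw [mul_assoc, ← mul_assoc, hgu, mul_assoc, ← mul_assoc _ (t a), huv]
      simp only [mul_assoc]
    obtain ⟨C, hC, -, hs⟩ := ih h3 hl.tail hy
    refine ⟨.cons a g c⁻¹ hc' C, ⟨fun hi => ?_, hC⟩, fun h => h.elim, ?_⟩
    · obtain ⟨k, l', rfl, hmem⟩ := hs _ hi
      exact (List.isChain_cons_cons.1 hl).1 ⟨rfl, hmem⟩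
    · rintro b ⟨rfl, c', hc'⟩
      exact ⟨_, l, rfl, c', by rw [edgeEmb_apply, hc']⟩

theorem exists_vertexHom_of_commute (hT : 𝒢.graph.IsMaximalTree T) (h𝒢 : 𝒢.WithoutCircuit)
    {s : V} {g : 𝒢.Gv s} (hg : g ≠ 1) {x : 𝒢.Pi1 T} (hx : Commute x (𝒢.vertexHom T s g)) :
    ∃ h, x = 𝒢.vertexHom T s h := by
  obtain ⟨l, hl⟩ := exists_rep hT x s s
  obtain ⟨m, hm, hr, -⟩ := hl.exists_reduced
  obtain ⟨C, hC, h1, -⟩ := hρ.exists_traj hm hr (u := g) (v := g) (by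
    rw [← hρ.vertex, ← hρ.mul, ← hρ.mul, hx.eq])
  obtain rfl := h1 (h𝒢 s g hg C hC)
  obtain ⟨g', -, rfl⟩ := hm
  exact ⟨g', rfl⟩

theorem centralizer_vertexHom (hT : 𝒢.graph.IsMaximalTree T) (h𝒢 : 𝒢.WithoutCircuit)
    {s : V} {g : 𝒢.Gv s} (hg : g ≠ 1) :
    Subgroup.centralizer {𝒢.vertexHom T s g} =
      (Subgroup.centralizer {g}).map (𝒢.vertexHom T s) := by
  ext x
  simp only [Subgroup.mem_centralizer_singleton_iff, Subgroup.mem_map]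
  constructor
  · intro hx
    obtain ⟨h, rfl⟩ := hρ.exists_vertexHom_of_commute hT h𝒢 hg (x := x) hx
    refine ⟨h, hρ.vertexHom_injective s ?_, rfl⟩
    rw [map_mul, map_mul, hx]
  · rintro ⟨h, hh, rfl⟩
    rw [← map_mul, hh, map_mul]

end IsTransport

/-- An element is elliptic if it lies in a conjugate of a vertex subgroup. -/
def IsElliptic (u : 𝒢.Pi1 T) : Prop :=
  ∃ (s : V) (x : 𝒢.Pi1 T) (g : 𝒢.Gv s), u = x * 𝒢.vertexHom T s g * x⁻¹

theorem IsElliptic.of_conj {u x : 𝒢.Pi1 T} (h : IsElliptic (x⁻¹ * u * x)) : IsElliptic u := by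
  obtain ⟨s, y, g, hy⟩ := h
  refine ⟨s, x * y, g, ?_⟩
  have hu : u = x * (x⁻¹ * u * x) * x⁻¹ := by group
  rw [hu, hy]
  group

end GraphOfGroups

/-! ### Periodic reduced words -/

namespace MultiHNN

variable {E : Type u₁} {K : Type u₂} [Group K] {M : E → Type u₃} [∀ e, Group (M e)]
  {ψ : ∀ a : E × Bool, M a.1 →* K} {H : Type*} [Group H] {j : K →* H} {t : E × Bool → H}

theorem val_replicate (l : List (K × (E × Bool))) (N : ℕ) :
    val j t (List.replicate N l).flatten = val j t l ^ N := by
  induction N with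
  | zero => simp
  | succ N ih => rw [List.replicate_succ, List.flatten_cons, val_append, ih, pow_succ']

theorem exists_val_take_replicate {l : List (K × (E × Bool))} (hl : l ≠ []) (N i : ℕ) :
    ∃ q r, r < l.length ∧ val j t ((List.replicate N l).flatten.take i) =
      val j t l ^ q * val j t (l.take r) := by
  have h0 := List.length_pos_iff.2 hl
  induction N generalizing i with
  | zero => exact ⟨0, 0, h0, by simp⟩
  | succ N ih =>
    rw [List.replicate_succ, List.flatten_cons]
    rcases lt_or_ge i l.length with hi | hi
    · exact ⟨0, i, hi, by rw [List.take_append_of_le_length hi.le, pow_zero, one_mul]⟩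
    · obtain ⟨q, r, hr, h⟩ := ih (i - l.length)
      refine ⟨q + 1, r, hr, ?_⟩
      rw [List.take_append, List.take_of_length_le hi, val_append, h, pow_succ', mul_assoc]

theorem Reduced.replicate {l : List (K × (E × Bool))} (h : Reduced ψ (l ++ l)) (N : ℕ) :
    Reduced ψ (List.replicate N l).flatten := by
  rcases eq_or_ne l [] with rfl | hl
  · simpa using h
  induction N with
  | zero => exact .nil
  | succ N ih =>
    cases N with
    | zero =>
      rw [List.replicate_one, List.flatten_singleton]
      exact List.IsChain.left_of_append h
    | succ N =>
      simp only [List.replicate_succ, List.flatten_cons] at ih ⊢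
      rw [← List.append_assoc]
      exact List.IsChain.append_overlap h ih hl

namespace IsHNN

/-- A periodic reduced word has infinite order. -/
theorem pow_ne_one (hH : IsHNN ψ j t) {l : List (K × (E × Bool))} (hl : l ≠ [])
    (hll : Reduced ψ (l ++ l)) {N : ℕ} (hN : N ≠ 0) : val j t l ^ N ≠ 1 := by
  intro h
  rw [← val_replicate, ← map_one j] at h
  have := congrArg List.length (hH.eq_nil (hll.replicate N) h)
  simp [hN, hl] at this

/-- An element commuting with a periodic reduced word maps some point of the axis to the axis. -/
theorem exists_val_take_of_commute (hH : IsHNN ψ j t) {l m : List (K × (E × Bool))}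
    (hl : l ≠ []) (hll : Reduced ψ (l ++ l)) (hm : Reduced ψ m) {g : K}
    (hc : Commute (val j t m * j g) (val j t l)) :
    ∃ (q q' r r' : ℕ) (k : K), r < l.length ∧ r' < l.length ∧
      val j t m * j g * (val j t l ^ q * val j t (l.take r)) =
        val j t l ^ q' * val j t (l.take r') * j k := by
  -- In `m P` and `P m` cancellation consumes at most `m.length` syllables of `P`, so at this length
  -- the surviving prefix of `m` is compared with a prefix of `P` alone.
  set P := (List.replicate (2 * m.length + 1) l).flatten with hP
  have hPr : Reduced ψ P := hll.replicate _
  have hPl : 2 * m.length + 1 ≤ P.length := by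
    have := List.length_pos_iff.2 hl
    simp only [hP, List.length_flatten, List.map_replicate, List.sum_replicate, smul_eq_mul]
    exact Nat.le_mul_of_pos_right _ this
  have hcP : val j t m * j g * val j t P = val j t P * (val j t m * j g) := by
    rw [hP, val_replicate]
    exact (hc.pow_right _).eq
  obtain ⟨i, k₁, hi, -, hr₁, he₁⟩ := hH.exists_reduced_append hm hPr g
  obtain ⟨i', k₂, hi', hi₂, hr₂, he₂⟩ := hH.exists_reduced_append hPr hm 1
  obtain ⟨x₁, hx₁⟩ := val_lmul (j := j) (t := t) k₁ (P.drop i)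
  obtain ⟨x₂, hx₂⟩ := val_lmul (j := j) (t := t) k₂ (m.drop i')
  have h₁ : val j t (m.take (m.length - i) ++ lmul k₁ (P.drop i)) * j x₁ =
      val j t m * j g * val j t P := by
    rw [val_append, mul_assoc, hx₁, ← mul_assoc, ← he₁, mul_assoc, ← val_append,
      List.take_append_drop]
  have h₂ : val j t (P.take (P.length - i') ++ lmul k₂ (m.drop i')) * j x₂ =
      val j t P * val j t m := by
    rw [val_append, mul_assoc, hx₂, ← mul_assoc, ← he₂, mul_assoc, ← val_append,
      List.take_append_drop, map_one, mul_one]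
  obtain ⟨-, h⟩ := hH.take_eq hr₁ hr₂ (k := 1) (x := x₁) (y := x₂ * g) (by
    rw [h₁, hcP, map_one, one_mul, map_mul, ← mul_assoc _ (j x₂), h₂, mul_assoc])
  obtain ⟨z, hz⟩ := h (m.length - i)
  rw [List.take_append_of_le_length (by simp), List.take_append_of_le_length (by
    rw [List.length_take]; omega), List.take_take, List.take_take, min_self,
    min_eq_left (by omega), map_one, one_mul] at hz
  obtain ⟨q, r, hr, e⟩ := exists_val_take_replicate (j := j) (t := t) hl (2 * m.length + 1) i
  obtain ⟨q', r', hr', e'⟩ := exists_val_take_replicate (j := j) (t := t) hl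
    (2 * m.length + 1) (m.length - i)
  refine ⟨q, q', r, r', z⁻¹ * k₁, hr, hr', ?_⟩
  rw [← e, ← e', ← hP, he₁, ← hz, map_mul, map_inv, mul_assoc, mul_inv_cancel_left]

end IsHNN

end MultiHNN

/-! ### Two facts on abstract groups -/

/-- A torsion-free group with a central cyclic subgroup of finite index is cyclic. -/
theorem isCyclic_of_zpowers_finiteIndex {G : Type*} [Group G] {c : G}
    (hc : c ∈ Subgroup.center G) (hf : (Subgroup.zpowers c).FiniteIndex)
    (htf : ∀ (x : G) (n : ℕ), n ≠ 0 → x ^ n = 1 → x = 1) : IsCyclic G := by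
  have hle : Subgroup.zpowers c ≤ Subgroup.center G := Subgroup.zpowers_le.2 hc
  have : (Subgroup.center G).FiniteIndex := Subgroup.finiteIndex_of_le hle
  have : (Subgroup.zpowers c).Normal :=
    ⟨fun x hx g => by rwa [Subgroup.mem_center_iff.1 (hle hx) g, mul_inv_cancel_right]⟩
  set n := (Subgroup.center G).index
  set m := (Subgroup.zpowers c).index
  have hm : ∀ x : G, x ^ m ∈ Subgroup.zpowers c := fun x => Subgroup.pow_index_mem _ x
  -- Transfer makes `x ↦ x ^ n` a homomorphism into the center, so `θ x = x ^ (n * m)` is one too;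
  -- its kernel is torsion.
  let θ : G →* Subgroup.zpowers c :=
    { toFun x := ⟨((MonoidHom.transferCenterPow G x : G)) ^ m, hm _⟩
      map_one' := by simp
      map_mul' x y := by
        ext
        rw [map_mul]
        exact (Commute.mul_pow
          (Subgroup.mem_center_iff.1 (MonoidHom.transferCenterPow G y).2 _) m) }
  refine isCyclic_of_injective θ ((injective_iff_map_eq_one θ).2 fun x hx => ?_)
  have h1 : (x ^ n) ^ m = 1 := congrArg Subtype.val hx
  rw [← pow_mul] at h1
  exact htf x _ (mul_ne_zero Subgroup.FiniteIndex.index_ne_zero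
    Subgroup.FiniteIndex.index_ne_zero) h1

/-- The centralizer of a conjugate of an element, as an isomorphic image. -/
theorem exists_centralizer_conj {G : Type*} [Group G] (u p : G) :
    ∃ f : Subgroup.centralizer {u} →* Subgroup.centralizer {p⁻¹ * u * p},
      Function.Injective f := by
  refine ⟨((MulAut.conj p⁻¹).toMonoidHom.comp (Subgroup.centralizer {u}).subtype).codRestrict
    _ ?_, ?_⟩
  · rintro ⟨x, hx⟩
    rw [Subgroup.mem_centralizer_singleton_iff] at hx ⊢
    have : p⁻¹ * x * p * (p⁻¹ * u * p) = p⁻¹ * (x * u) * p := by group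
    simp only [MulEquiv.toMonoidHom_eq_coe, MonoidHom.coe_comp, MonoidHom.coe_coe,
      Function.comp_apply, Subgroup.coe_subtype, MulAut.conj_apply, inv_inv]
    rw [this, hx]
    group
  · intro x y hxy
    exact Subtype.ext ((MulAut.conj p⁻¹).injective (congrArg Subtype.val hxy))

/-! ### Centralizers of non-elliptic elements -/

namespace GraphOfGroups

open OrientedGraph MultiHNN

variable {V : Type u₁} {E : Type u₂} {𝒢 : GraphOfGroups.{u₁, u₂, u₃, u₄} V E} {T : Set E}

theorem nonempty_of_ne_one {u : 𝒢.Pi1 T} (hu : u ≠ 1) : Nonempty V := by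
  by_contra hV
  rw [not_nonempty_iff] at hV
  refine hu (Pi1.induction (p := fun x => x = 1) rfl (fun x y hx hy => ?_)
    (fun s => isEmptyElim s) (fun a => isEmptyElim (𝒢.graph.org a)) u)
  rw [hx, hy, mul_one]

theorem Rep.mul_right {s r : V} {l : List ((∀ s, 𝒢.Gv s) × (E × Bool))} {x : 𝒢.Pi1 T}
    (h : Rep s r l x) (g : 𝒢.Gv r) : Rep s r l (x * 𝒢.vertexHom T r g) := by
  simpa [MultiHNN.lmul] using (h.append (m := []) (y := 𝒢.vertexHom T r g) ⟨g, rfl, rfl⟩).choose_spec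

namespace IsTransport

variable {H : Type*} [Group H] {j : (∀ s, 𝒢.Gv s) →* H} {t : E × Bool → H}
  {ρ : V → V → 𝒢.Pi1 T → H} (hρ : IsTransport j t ρ)

include hρ

/-- If `y` were a nontrivial conjugate of a vertex element, the vertex case would place the
corresponding conjugate of `u` in the same vertex subgroup. -/
theorem eq_one_of_isElliptic (hT : 𝒢.graph.IsMaximalTree T) (h𝒢 : 𝒢.WithoutCircuit)
    {u y : 𝒢.Pi1 T} (hu : ¬ IsElliptic u) (hy : IsElliptic y) (hc : Commute u y) : y = 1 := by
  obtain ⟨s, p, g, rfl⟩ := hy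
  by_contra hne
  have hg : g ≠ 1 := by
    rintro rfl
    simp at hne
  obtain ⟨h, hh⟩ := hρ.exists_vertexHom_of_commute hT h𝒢 hg (x := p⁻¹ * u * p) (by
    have h1 := hc.eq
    have h2 : u * (p * 𝒢.vertexHom T s g * p⁻¹) = p * (p⁻¹ * u * p * 𝒢.vertexHom T s g) * p⁻¹ := by
      group
    have h3 : p * 𝒢.vertexHom T s g * p⁻¹ * u = p * (𝒢.vertexHom T s g * (p⁻¹ * u * p)) * p⁻¹ := by
      group
    rw [h2, h3] at h1
    exact mul_left_cancel (mul_right_cancel h1))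
  exact hu (IsElliptic.of_conj (x := p) ⟨s, 1, h, by simpa using hh⟩)

/-- An element which is not elliptic is conjugate to the value of a cyclically reduced word. -/
theorem exists_cyclically_reduced [Nonempty V] (hT : 𝒢.graph.IsMaximalTree T) {u : 𝒢.Pi1 T}
    (hu : ¬ IsElliptic u) :
    ∃ (p : 𝒢.Pi1 T) (s : V) (l : List ((∀ s, 𝒢.Gv s) × (E × Bool))), l ≠ [] ∧
      Rep s s l (p⁻¹ * u * p) ∧ ρ s s (p⁻¹ * u * p) = val j t l ∧
      Reduced 𝒢.edgeEmb (l ++ l) := by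
  classical
  -- The length is minimized over all conjugates of `u` and all base vertices, so that rotating a
  -- minimal word stays within the competition.
  have hex : ∃ (n : ℕ) (s : V) (p : 𝒢.Pi1 T) (l : List ((∀ s, 𝒢.Gv s) × (E × Bool))),
      Rep s s l (p⁻¹ * u * p) ∧ l.length = n := by
    obtain ⟨s⟩ := ‹Nonempty V›
    obtain ⟨l, hl⟩ := exists_rep hT u s s
    exact ⟨_, s, 1, l, by simpa using hl, rfl⟩
  have hred : ∀ {s : V} {p : 𝒢.Pi1 T} {l : List ((∀ s, 𝒢.Gv s) × (E × Bool))},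
      Rep s s l (p⁻¹ * u * p) → l.length = Nat.find hex → Reduced 𝒢.edgeEmb l := by
    intro s p l hl hn
    by_contra hr
    obtain ⟨l', h1, h2⟩ := hl.exists_shorter hr
    exact Nat.find_min hex (hn ▸ h2) ⟨s, p, l', h1, rfl⟩
  obtain ⟨s, p₀, l₀, h₀, hn₀⟩ := Nat.find_spec hex
  have hl₀ := hred h₀ hn₀
  obtain ⟨e, he⟩ := hρ.exists_eq h₀
  cases l₀ with
  | nil =>
    obtain ⟨g, -, hg⟩ := h₀
    exact (hu (IsElliptic.of_conj (x := p₀) ⟨s, 1, g, by simpa using hg⟩)).elim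
  | cons q m =>
    obtain ⟨k₀, a⟩ := q
    -- Conjugation moves the trailing vertex element `e` into the first syllable, making the value
    -- exactly that of the word.
    obtain ⟨p, hp⟩ : ∃ p, p = p₀ * 𝒢.vertexHom T s e⁻¹ := ⟨_, rfl⟩
    have hpu : p⁻¹ * u * p =
        𝒢.vertexHom T s e * (p₀⁻¹ * u * p₀) * 𝒢.vertexHom T s e⁻¹ := by
      rw [hp, map_inv]; group
    have hR : Rep s s ((𝒢.emb s e * k₀, a) :: m) (p⁻¹ * u * p) := by
      rw [hpu]
      exact (h₀.lmul e).mul_right e⁻¹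
    have hv : ρ s s (p⁻¹ * u * p) = val j t ((𝒢.emb s e * k₀, a) :: m) := by
      rw [hpu, hρ.mul _ s, hρ.mul _ s, he, hρ.vertex, hρ.vertex]
      simp [mul_assoc]
    have hr : Reduced 𝒢.edgeEmb ((𝒢.emb s e * k₀, a) :: m) := hl₀.lmul (𝒢.emb s e)
    refine ⟨p, s, _, List.cons_ne_nil _ _, hR, hv, ?_⟩
    generalize 𝒢.emb s e * k₀ = k at *
    obtain ⟨g, y, rfl, rfl, hy, hx⟩ := hR
    have hone : Rep (𝒢.graph.org a) (𝒢.graph.ext a) [(𝒢.emb _ g, a)]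
        (𝒢.vertexHom T _ g * 𝒢.edge T a) := ⟨g, 1, rfl, rfl, ⟨1, rfl, by simp⟩, by simp⟩
    have hvone : ρ (𝒢.graph.org a) (𝒢.graph.ext a) (𝒢.vertexHom T _ g * 𝒢.edge T a) =
        j (𝒢.emb _ g) * t a := by
      rw [hρ.mul _ (𝒢.graph.org a), hρ.vertex, hρ.edge]
    have hvy : ρ (𝒢.graph.ext a) (𝒢.graph.org a) y = val j t m := by
      rw [hx, hρ.mul _ (𝒢.graph.ext a), hvone, val_cons] at hv
      exact mul_left_cancel hv
    obtain ⟨g', hg'⟩ := hy.append hone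
    have hred' := hred (p := p * (𝒢.vertexHom T _ g * 𝒢.edge T a)) (by
      have : (p * (𝒢.vertexHom T _ g * 𝒢.edge T a))⁻¹ * u *
          (p * (𝒢.vertexHom T _ g * 𝒢.edge T a)) =
          y * (𝒢.vertexHom T _ g * 𝒢.edge T a) := by
        calc _ = (𝒢.vertexHom T _ g * 𝒢.edge T a)⁻¹ * (p⁻¹ * u * p) *
              (𝒢.vertexHom T _ g * 𝒢.edge T a) := by group
          _ = _ := by rw [hx]; group
      rw [this]
      exact hg') (by rw [← hn₀]; simp [MultiHNN.lmul])
    obtain ⟨e', he'⟩ := hρ.exists_eq hg'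
    -- The factor `g'` introduced by rotation changes the last syllable only within its edge coset,
    -- so it does not affect pinches.
    have hmem : (𝒢.emb _ g' * 𝒢.emb _ g)⁻¹ * 𝒢.emb _ g ∈ (𝒢.edgeEmb a).range := by
      obtain ⟨h, m', hm', hh⟩ := hρ.isHNN.head (g := 𝒢.emb _ g' * 𝒢.emb _ g) (a := a) (l := [])
        (m := [(𝒢.emb _ g, a)]) (x := 𝒢.emb _ e') (y := 1) (.singleton _) (.singleton _) (by
          rw [hρ.mul _ (𝒢.graph.org a), hvone, hvy, val_append, mul_assoc] at he'
          simpa [MultiHNN.lmul, mul_assoc] using (mul_left_cancel he').symm)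
      simp only [List.cons.injEq, Prod.mk.injEq, and_true] at hm'
      rwa [← hm'.1] at hh
    have hrot : Reduced 𝒢.edgeEmb (m ++ [(𝒢.emb _ g, a)]) := by
      refine List.IsChain.append hr.tail (.singleton _) ?_
      intro b hb c hc
      obtain rfl : (𝒢.emb _ g, a) = c := by simpa using hc
      have h1 := List.isChain_append.1 hred'
      intro hpinch
      refine h1.2.2 b hb _ rfl ⟨hpinch.1, ?_⟩
      rw [← Subgroup.inv_mem_iff, ← Subgroup.mul_mem_cancel_right _ hpinch.2]
      exact hmem
    have hsq : Reduced 𝒢.edgeEmb ([(𝒢.emb _ g, a)] ++ m ++ [(𝒢.emb _ g, a)]) := by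
      rcases eq_or_ne m [] with rfl | hm
      · exact List.isChain_pair.2 fun h => inv_ne_self a h.1.symm
      · exact List.IsChain.append_overlap hr hrot hm
    change List.IsChain _ _
    simpa using List.IsChain.append_overlap hsq (l₃ := m) hr (List.cons_ne_nil _ _)

theorem pow_ne_one [Nonempty V] (hT : 𝒢.graph.IsMaximalTree T) {u : 𝒢.Pi1 T}
    (hu : ¬ IsElliptic u) {N : ℕ} (hN : N ≠ 0) : u ^ N ≠ 1 := by
  intro h
  obtain ⟨p, s, l, hl, -, hv, hr⟩ := hρ.exists_cyclically_reduced hT hu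
  refine hρ.isHNN.pow_ne_one hl hr hN ?_
  rw [← hv]
  change hρ.toHom s _ ^ N = 1
  have : (p⁻¹ * u * p) ^ N = 1 := by
    simpa [h] using conj_pow (i := N) (a := p⁻¹) (b := u)
  rw [← map_pow, this, _root_.map_one]

/-- An element of the fundamental group whose value fixes the end of a path is elliptic. -/
theorem isElliptic_of_val_take (hT : 𝒢.graph.IsMaximalTree T) {s : V}
    {l : List ((∀ s, 𝒢.Gv s) × (E × Bool))} {x y : 𝒢.Pi1 T} (h : Rep s s l x) {i : ℕ}
    {k : ∀ s, 𝒢.Gv s} (hy : ρ s s y * val j t (l.take i) = val j t (l.take i) * j k) :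
    IsElliptic y := by
  obtain ⟨r, q, hq⟩ := h.exists_take i
  obtain ⟨g, hg⟩ := hρ.exists_eq hq
  have h1 : ρ r r (q⁻¹ * y * q) = j ((𝒢.emb r g)⁻¹ * k * 𝒢.emb r g) := by
    have h2 : ρ s r q * ρ r r (q⁻¹ * y * q) = ρ s s y * ρ s r q := by
      rw [← hρ.mul, ← hρ.mul]
      congr 1
      group
    apply mul_left_cancel (a := ρ s r q)
    rw [h2, hg, ← mul_assoc, hy]
    simp [mul_assoc]
  obtain ⟨g', hg'⟩ := hρ.exists_vertexHom_eq hT h1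
  exact IsElliptic.of_conj (x := q) ⟨r, 1, g', by simpa using hg'⟩

theorem finiteIndex_zpowers (hT : 𝒢.graph.IsMaximalTree T) (h𝒢 : 𝒢.WithoutCircuit)
    {s : V} {l : List ((∀ s, 𝒢.Gv s) × (E × Bool))} {u : 𝒢.Pi1 T} (hu : ¬ IsElliptic u)
    (hl : l ≠ []) (hR : Rep s s l u) (hv : ρ s s u = val j t l)
    (hll : Reduced 𝒢.edgeEmb (l ++ l)) :
    (Subgroup.zpowers (⟨u, Subgroup.mem_centralizer_singleton_iff.2 rfl⟩ :
      Subgroup.centralizer {u})).FiniteIndex := by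
  set Z := Subgroup.centralizer {u}
  set c : Z := ⟨u, Subgroup.mem_centralizer_singleton_iff.2 rfl⟩ with hc
  have hcc : ∀ z : Z, Commute z c := fun z =>
    Subtype.ext (Subgroup.mem_centralizer_singleton_iff.1 z.2)
  have key : ∀ z : Z, ∃ rr : Fin l.length × Fin l.length, ∃ (a b : ℤ) (k : ∀ s, 𝒢.Gv s),
      hρ.toHom s (c ^ a * z * c ^ b : Z) * val j t (l.take rr.1) =
        val j t (l.take rr.2) * j k := by
    intro z
    obtain ⟨m₀, hm₀⟩ := exists_rep hT (z : 𝒢.Pi1 T) s s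
    obtain ⟨m, hm, hmr, -⟩ := hm₀.exists_reduced
    obtain ⟨g, hg⟩ := hρ.exists_eq hm
    have hcom : Commute (val j t m * j (𝒢.emb s g)) (val j t l) := by
      rw [← hg, ← hv]
      exact Commute.map (congrArg Subtype.val (hcc z).eq) (hρ.toHom s)
    obtain ⟨q, q', r, r', k, hr, hr', h⟩ :=
      hρ.isHNN.exists_val_take_of_commute hl hll hmr hcom
    -- The full periods on both sides are moved into powers of `u`, leaving prefixes within one
    -- period.
    refine ⟨(⟨r, hr⟩, ⟨r', hr'⟩), -q', q, k, ?_⟩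
    rw [← hg, ← hv] at h
    change hρ.toHom s z * (hρ.toHom s u ^ q * _) = hρ.toHom s u ^ q' * _ * _ at h
    simp only [Subgroup.coe_mul, Subgroup.coe_inv, Subgroup.coe_pow, hc, map_mul, map_inv, map_pow,
      zpow_neg, zpow_natCast]
    rw [mul_assoc, mul_assoc, h]
    simp [mul_assoc]
  choose F a b k hF using key
  have hinj : Function.Injective fun q : Z ⧸ Subgroup.zpowers c => F q.out := by
    intro q₁ q₂ h
    dsimp only at h
    have h₁ := hF q₁.out
    have h₂ := hF q₂.out
    rw [← h] at h₂
    generalize F q₁.out = rr at *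
    generalize a q₁.out = a₁, b q₁.out = b₁, k q₁.out = k₁ at *
    generalize a q₂.out = a₂, b q₂.out = b₂, k q₂.out = k₂ at *
    -- With equal pairs, both elements send the first prefix to the second modulo the base group, so
    -- their quotient fixes the second.
    have hell : IsElliptic (((c ^ a₁ * q₁.out * c ^ b₁) *
        (c ^ a₂ * q₂.out * c ^ b₂)⁻¹ : Z) : 𝒢.Pi1 T) := by
      refine hρ.isElliptic_of_val_take hT hR (i := rr.2) (k := k₁ * k₂⁻¹) ?_
      change hρ.toHom s _ * _ = _
      have aux : ∀ {A B P P' X Y : H}, A * P = P' * X → B * P = P' * Y →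
          A * B⁻¹ * P' = P' * (X * Y⁻¹) := by
        intro A B P P' X Y h h'
        rw [← mul_assoc, ← h, eq_mul_inv_of_mul_eq h'.symm]
        group
      rw [Subgroup.coe_mul, Subgroup.coe_inv, map_mul, map_inv, map_mul j, map_inv]
      exact aux h₁ h₂
    have hone := hρ.eq_one_of_isElliptic hT h𝒢 hu hell
      (congrArg Subtype.val (hcc _).symm.eq)
    have hone' : c ^ a₁ * q₁.out * c ^ b₁ = c ^ a₂ * q₂.out * c ^ b₂ :=
      mul_inv_eq_one.1 (Subtype.ext hone)
    rw [← Quotient.out_eq q₁, ← Quotient.out_eq q₂]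
    refine QuotientGroup.eq.2 ⟨a₁ + b₁ - a₂ - b₂, ?_⟩
    dsimp only
    rw [eq_inv_mul_iff_mul_eq]
    have h₃ := ((hcc q₁.out).zpow_right a₁).eq
    have h₄ := ((hcc q₂.out).zpow_right a₂).eq
    rw [← h₃, ← h₄, mul_assoc, mul_assoc, ← zpow_add, ← zpow_add] at hone'
    rw [← mul_right_cancel_iff (a := c ^ (a₂ + b₂)), ← hone', mul_assoc, ← zpow_add]
    congr 2
    ring
  have := Finite.of_injective _ hinj
  exact Subgroup.finiteIndex_of_finite_quotient

theorem centralizer_of_not_isElliptic [Nonempty V] (hT : 𝒢.graph.IsMaximalTree T)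
    (h𝒢 : 𝒢.WithoutCircuit) {u : 𝒢.Pi1 T} (hu : ¬ IsElliptic u) :
    IsCyclic (Subgroup.centralizer {u}) ∧ Infinite (Subgroup.centralizer {u}) := by
  constructor
  · obtain ⟨p, s, l, hl, hR, hv, hr⟩ := hρ.exists_cyclically_reduced hT hu
    have hu' : ¬ IsElliptic (p⁻¹ * u * p) := fun h => hu h.of_conj
    obtain ⟨f, hf⟩ := exists_centralizer_conj u p
    have : IsCyclic (Subgroup.centralizer {p⁻¹ * u * p}) := by
      refine isCyclic_of_zpowers_finiteIndex (Subgroup.mem_center_iff.2 fun z => ?_)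
        (hρ.finiteIndex_zpowers hT h𝒢 hu' hl hR hv hr) fun x n hn hx => ?_
      · exact Subtype.ext (Subgroup.mem_centralizer_singleton_iff.1 z.2)
      -- A torsion element is elliptic, since non-elliptic ones have infinite order; being elliptic
      -- and commuting with the conjugate of `u`, it is 1.
      · by_contra hne
        refine hne (Subtype.ext (hρ.eq_one_of_isElliptic hT h𝒢 hu' ?_
          (Subgroup.mem_centralizer_singleton_iff.1 x.2).symm))
        by_contra hx'
        exact hρ.pow_ne_one hT hx' hn (congrArg Subtype.val hx)
    exact isCyclic_of_injective f hf
  · refine Infinite.of_injective (fun n : ℕ =>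
      (⟨u, Subgroup.mem_centralizer_singleton_iff.2 rfl⟩ : Subgroup.centralizer {u}) ^ n)
      (injective_pow_iff_not_isOfFinOrder.2 fun h => ?_)
    obtain ⟨n, hn, h⟩ := isOfFinOrder_iff_pow_eq_one.1 h
    exact hρ.pow_ne_one hT hu hn.ne' (congrArg Subtype.val h)

end IsTransport

end GraphOfGroups

theorem mainTheorem9 {V : Type u₁} {E : Type u₂} [Finite V] [Finite E]
    (𝒢 : GraphOfGroups.{u₁, u₂, u₃, u₄} V E) (T : Set E)
    (hT : 𝒢.graph.IsMaximalTree T) (h𝒢 : 𝒢.WithoutCircuit)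
    (u : 𝒢.Pi1 T) (hu : u ≠ 1) :
    (∀ (s : V) (g : 𝒢.Gv s), 𝒢.vertexHom T s g = u →
      Subgroup.centralizer {u} = (Subgroup.centralizer {g}).map (𝒢.vertexHom T s)) ∧
    ((¬ ∃ (s : V) (x : 𝒢.Pi1 T) (g : 𝒢.Gv s), u = x * 𝒢.vertexHom T s g * x⁻¹) →
      IsCyclic (Subgroup.centralizer {u}) ∧ Infinite (Subgroup.centralizer {u})) := by
  obtain ⟨H, _, j, t, ρ, hρ⟩ := GraphOfGroups.exists_isTransport hT
  have := GraphOfGroups.nonempty_of_ne_one hu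
  refine ⟨?_, hρ.centralizer_of_not_isElliptic hT h𝒢⟩
  rintro s g rfl
  exact hρ.centralizer_vertexHom hT h𝒢 fun h => hu (by rw [h, map_one])
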